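/- Let $T$ be a caterpillar on $n$ vertices, that is, a finite tree in which the removal of all vertices of degree one leaves a (non-empty, possibly one-vertex) path. A cutpoint of $T$ is a vertex whose removal, together with its incident edges, disconnects $T$; assume that every cutpoint of $T$ has degree at least $3$, and let $s$ be the number of cutpoints. Let $L(T)$ be the line graph of $T$ (its vertices are the edges of $T$, two of them being adjacent if they are distinct and share an endpoint), let $\Bbbk$ be any field, let $R=\Bbbk[x_e : e\in E(T)]$, and let $I(L(T))=(x_e x_f : \{e,f\}\in E(L(T)))\subseteq R$ be the edge ideal of $L(T)$. Then $s\le n-1$ and $$\operatorname{height} I(L(T)) = n-1-s,$$ and the minimal size of a minimal vertex cover of $L(T)$ is $n-1-s$. -/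

import Mathlib

namespace SimpleGraph

/-- A cutpoint: a vertex whose removal (with all incident edges) leaves a disconnected graph.
The graph with no vertices does not count as disconnected. -/
def IsCutpoint {V : Type*} (G : SimpleGraph V) (u : V) : Prop :=
  ¬ (G.induce {v | v ≠ u}).Preconnected

/-- A caterpillar: a tree in which the removal of all vertices of degree one leaves a
path on `m + 1 ≥ 1` vertices (the backbone), with no further edges between its vertices. -/
def IsCaterpillar {V : Type*} (G : SimpleGraph V) [G.LocallyFinite] : Prop :=
  G.IsTree ∧ ∃ m : ℕ, Nonempty (G.induce {v | G.degree v ≠ 1} ≃g pathGraph (m + 1))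

/-- The edge ideal of `G` over `k`, generated by the products `x_u x_v` over the edges `{u, v}`,
in the polynomial ring whose variables are the vertices of `G`. -/
noncomputable def edgeIdeal {V : Type*} (k : Type*) [Field k] (G : SimpleGraph V) : Ideal (MvPolynomial V k) :=
  Ideal.span {p | ∃ u v : V, G.Adj u v ∧ p = MvPolynomial.X u * MvPolynomial.X v}

end SimpleGraph

/-! The height of an edge ideal is the least size of a vertex cover: the variables of a cover `C`
generate a prime of height `|C|` containing the ideal, and the variables lying in any prime over the
ideal form a cover. In the line graph, complements of covers are matchings of `T`. Every edge of `T`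
contains a cutpoint, so a matching has at most `s` edges; joining each cutpoint to a leaf attains
`s` of the `n - 1` edges. -/

namespace MvPolynomial

variable {σ : Type*} (k : Type*) [Field k]

open Classical in
/-- The endomorphism of the polynomial ring that sends the variables in `C` to zero and fixes
the others. -/
noncomputable def killVars (C : Set σ) : MvPolynomial σ k →ₐ[k] MvPolynomial σ k :=
  aeval fun i => if i ∈ C then 0 else X i

variable {k}

theorem killVars_X_of_mem {C : Set σ} {i : σ} (h : i ∈ C) :
    killVars k C (X i) = 0 := by
  simp [killVars, h]

theorem killVars_X_of_notMem {C : Set σ} {i : σ} (h : i ∉ C) :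
    killVars k C (X i) = X i := by
  simp [killVars, h]

theorem sub_killVars_mem_span_X_image (C : Set σ) (p : MvPolynomial σ k) :
    p - killVars k C p ∈ Ideal.span (X '' C : Set (MvPolynomial σ k)) := by
  induction p using MvPolynomial.induction_on with
  | C a => simp [killVars]
  | add p q hp hq =>
    rw [map_add, add_sub_add_comm]
    exact add_mem hp hq
  | mul_X p i hp =>
    by_cases hi : i ∈ C
    · rw [map_mul, killVars_X_of_mem hi, mul_zero, sub_zero]
      exact Ideal.mul_mem_left _ _ (Ideal.subset_span ⟨i, hi, rfl⟩)
    · rw [map_mul, killVars_X_of_notMem hi, ← sub_mul]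
      exact Ideal.mul_mem_right _ _ hp

theorem ker_killVars (C : Set σ) :
    RingHom.ker (killVars k C) = Ideal.span (X '' C : Set (MvPolynomial σ k)) := by
  refine le_antisymm (fun p hp => ?_) (Ideal.span_le.mpr ?_)
  · have h := sub_killVars_mem_span_X_image C p
    rwa [(RingHom.mem_ker).mp hp, sub_zero] at h
  · rintro _ ⟨i, hi, rfl⟩
    exact killVars_X_of_mem hi

theorem isPrime_span_X_image (C : Set σ) :
    (Ideal.span (X '' C : Set (MvPolynomial σ k))).IsPrime := by
  rw [← ker_killVars]
  exact RingHom.ker_isPrime _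

theorem X_notMem_span_X_image {C : Set σ} {i : σ} (h : i ∉ C) :
    (X i : MvPolynomial σ k) ∉ Ideal.span (X '' C : Set (MvPolynomial σ k)) := by
  rw [← ker_killVars, RingHom.mem_ker, killVars_X_of_notMem h]
  exact X_ne_zero i

/-- Adjoining the variables one at a time gives a strict chain of primes. -/
theorem card_le_height_span_X_image (C : Finset σ) :
    (C.card : ℕ∞) ≤ (Ideal.span (X '' (C : Set σ) : Set (MvPolynomial σ k))).height := by
  classical
  induction C using Finset.induction_on with
  | empty => simp
  | insert a C ha ih =>
    have := isPrime_span_X_image (k := k) (C : Set σ)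
    have := isPrime_span_X_image (k := k) ((insert a C : Finset σ) : Set σ)
    have hlt : Ideal.span (X '' (C : Set σ) : Set (MvPolynomial σ k)) <
        Ideal.span (X '' ((insert a C : Finset σ) : Set σ)) := by
      refine lt_of_le_of_ne (Ideal.span_mono (Set.image_mono (by simp))) fun h => ?_
      refine X_notMem_span_X_image (k := k) (C := (C : Set σ)) (i := a) (by simpa) ?_
      rw [h]
      exact Ideal.subset_span ⟨a, by simp, rfl⟩
    rw [Finset.card_insert_of_notMem ha, Nat.cast_add, Nat.cast_one]
    exact (add_le_add_left ih 1).trans (Ideal.height_add_one_le_of_lt_of_isPrime hlt)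

theorem height_span_X_image [Finite σ] (C : Set σ) :
    (Ideal.span (X '' C : Set (MvPolynomial σ k))).height = C.ncard := by
  have := isPrime_span_X_image (k := k) C
  refine le_antisymm ?_ ?_
  · rw [← Set.ncard_image_of_injective C (X_injective (R := k))]
    -- Krull's height theorem; the ideal, being prime, is its own minimal prime.
    refine Ideal.height_le_card_of_mem_minimalPrimes_span (Set.toFinite _) ?_
    rw [Ideal.minimalPrimes_eq_subsingleton_self]
    rfl
  · have h := card_le_height_span_X_image (k := k) C.toFinite.toFinset
    rwa [Set.Finite.coe_toFinset, ← Set.ncard_eq_toFinset_card] at h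

end MvPolynomial

namespace SimpleGraph

open MvPolynomial

section EdgeIdeal

variable {V : Type*} {k : Type*} [Field k] {G : SimpleGraph V}

theorem IsVertexCover.edgeIdeal_le {C : Set V} (hC : G.IsVertexCover C) :
    G.edgeIdeal k ≤ Ideal.span (X '' C) := by
  refine Ideal.span_le.mpr ?_
  rintro _ ⟨u, v, huv, rfl⟩
  rcases hC huv with h | h
  · exact Ideal.mul_mem_right _ _ (Ideal.subset_span ⟨u, h, rfl⟩)
  · exact Ideal.mul_mem_left _ _ (Ideal.subset_span ⟨v, h, rfl⟩)

theorem isVertexCover_of_edgeIdeal_le {P : Ideal (MvPolynomial V k)} [P.IsPrime]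
    (h : G.edgeIdeal k ≤ P) : G.IsVertexCover {v | X v ∈ P} := fun u v huv =>
  Ideal.IsPrime.mem_or_mem ‹_› (h (Ideal.subset_span ⟨u, v, huv, rfl⟩))

/-- The height of the edge ideal is the least size of a vertex cover. -/
theorem height_edgeIdeal_eq [Finite V] {m : ℕ}
    (hm : IsLeast {m : ℕ | ∃ C : Set V, G.IsVertexCover C ∧ C.ncard = m} m) :
    (G.edgeIdeal k).height = m := by
  obtain ⟨⟨C, hC, rfl⟩, hmin⟩ := hm
  refine le_antisymm ?_ ?_
  · rw [← height_span_X_image (k := k)]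
    exact Ideal.height_mono hC.edgeIdeal_le
  · rw [Ideal.height_eq_inf_minimalPrimes]
    refine le_iInf₂ fun P hP => ?_
    have := hP.1.1
    have hcov := isVertexCover_of_edgeIdeal_le hP.1.2
    have hle : Ideal.span (X '' {v | X v ∈ P}) ≤ P := Ideal.span_le.mpr <| by
      rintro _ ⟨v, hv, rfl⟩
      exact hv
    refine le_trans ?_ (Ideal.height_mono hle)
    rw [height_span_X_image]
    exact_mod_cast hmin ⟨_, hcov, rfl⟩

theorem isLeast_minimal_isVertexCover [Finite V] {m : ℕ}
    (hm : IsLeast {m : ℕ | ∃ C : Set V, G.IsVertexCover C ∧ C.ncard = m} m) :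
    IsLeast {m : ℕ | ∃ C : Set V, Minimal G.IsVertexCover C ∧ C.ncard = m} m := by
  obtain ⟨⟨C, hC, rfl⟩, hmin⟩ := hm
  refine ⟨⟨C, ⟨hC, fun D hD hDC => ?_⟩, rfl⟩, ?_⟩
  · exact (Set.eq_of_subset_of_ncard_le hDC (hmin ⟨D, hD, rfl⟩)).ge
  · rintro _ ⟨D, hD, rfl⟩
    exact hmin ⟨D, hD.1, rfl⟩

end EdgeIdeal

section Caterpillar

variable {V : Type*} {T : SimpleGraph V}

/-- A walk from `b` to `a` avoiding `v`, preceded by the edge `vb`, would bypass the bridge `va`. -/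
theorem IsAcyclic.isCutpoint_of_adj_of_adj (hT : T.IsAcyclic) {v a b : V} (ha : T.Adj v a)
    (hb : T.Adj v b) (hab : a ≠ b) : T.IsCutpoint v := by
  intro h
  have hbridge := isAcyclic_iff_forall_isBridge.mp hT ((T.mem_edgeSet).mpr ha)
  rw [isBridge_iff] at hbridge
  refine hbridge ?_
  have hba := h ⟨b, hb.ne'⟩ ⟨a, ha.ne'⟩
  let f : T.induce {w | w ≠ v} →g T.deleteEdges {s(v, a)} :=
    { toFun := Subtype.val
      map_rel' := by
        rintro ⟨x, hx⟩ ⟨y, hy⟩ hxy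
        have hx' : x ≠ v := hx
        have hy' : y ≠ v := hy
        simp_all }
  have hvb : (T.deleteEdges {s(v, a)}).Adj v b := by
    simp [hb, hab.symm, ha.ne]
  exact hvb.reachable.trans (hba.map f)

variable [Fintype V] [DecidableRel T.Adj]

theorem IsAcyclic.isCutpoint_of_adj (hT : T.IsAcyclic) {v a : V} (ha : T.Adj v a)
    (hv : T.degree v ≠ 1) : T.IsCutpoint v := by
  have hpos : 0 < T.degree v := (T.degree_pos_iff_exists_adj v).mpr ⟨a, ha⟩
  obtain ⟨b, hb, hba⟩ := Finset.exists_mem_ne (s := T.neighborFinset v)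
    (by rw [card_neighborFinset_eq_degree]; omega) a
  exact hT.isCutpoint_of_adj_of_adj ha ((T.mem_neighborFinset v b).mp hb) hba.symm

theorem Connected.degree_eq_one_of_adj (hT : T.Connected) {u v : V} (huv : T.Adj u v)
    (hu : T.degree u = 1) (hv : T.degree v = 1) (w : V) : T.degree w = 1 := by
  obtain ⟨u', hu'⟩ := degree_eq_one_iff_existsUnique_adj.mp hu
  obtain ⟨v', hv'⟩ := degree_eq_one_iff_existsUnique_adj.mp hv
  have key : w = u ∨ w = v := by
    have hr := (reachable_iff_reflTransGen u w).mp (hT.preconnected u w)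
    induction hr with
    | refl => exact Or.inl rfl
    | tail _ hxy ih =>
      rcases ih with rfl | rfl
      · exact Or.inr ((hu'.2 _ hxy).trans (hu'.2 _ huv).symm)
      · exact Or.inl ((hv'.2 _ hxy).trans (hv'.2 _ huv.symm).symm)
  rcases key with rfl | rfl <;> assumption

/-- In a caterpillar every edge has a cutpoint among its endpoints. -/
theorem IsCaterpillar.exists_isCutpoint_mem (hT : T.IsCaterpillar) (e : T.edgeSet) :
    ∃ v, T.IsCutpoint v ∧ v ∈ e.1 := by
  obtain ⟨htree, m, ⟨φ⟩⟩ := hT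
  obtain ⟨e, he⟩ := e
  induction e using Sym2.ind with
  | _ u v =>
    have huv : T.Adj u v := he
    by_cases hu : T.degree u = 1
    · by_cases hv : T.degree v = 1
      -- Two adjacent leaves would be the whole tree, but the backbone has a vertex `φ.symm 0`,
      -- which is not a leaf.
      · exact absurd (htree.connected.degree_eq_one_of_adj huv hu hv _) (φ.symm 0).2
      · exact ⟨v, htree.isAcyclic.isCutpoint_of_adj huv.symm hv, by simp⟩
    · exact ⟨u, htree.isAcyclic.isCutpoint_of_adj huv hu, by simp⟩

/-- In a caterpillar every vertex of degree at least three is adjacent to a leaf. -/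
theorem IsCaterpillar.exists_adj_degree_eq_one (hT : T.IsCaterpillar) {v : V}
    (hv : 3 ≤ T.degree v) : ∃ w, T.Adj v w ∧ T.degree w = 1 := by
  obtain ⟨-, m, ⟨φ⟩⟩ := hT
  by_contra! hcon
  have hv1 : T.degree v ≠ 1 := by omega
  rw [← card_neighborFinset_eq_degree] at hv
  -- Without leaf neighbours, `v` would have three neighbours on the backbone, where a vertex has at
  -- most two.
  obtain ⟨a, ha, b, hb, c, hc, hab, hac, hbc⟩ := Finset.two_lt_card.mp hv
  rw [mem_neighborFinset] at ha hb hc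
  have hadj {w : V} (hw : T.Adj v w) :=
    pathGraph_adj.mp ((φ.map_adj_iff (v := ⟨v, hv1⟩) (w := ⟨w, hcon w hw⟩)).mpr hw)
  have hne {x y : V} (hx : T.Adj v x) (hy : T.Adj v y) (hxy : x ≠ y) :
      (φ ⟨x, hcon x hx⟩).val ≠ (φ ⟨y, hcon y hy⟩).val := fun h =>
    hxy (congrArg Subtype.val (φ.injective (Fin.ext h)))
  have := hadj ha
  have := hadj hb
  have := hadj hc
  have := hne ha hb hab
  have := hne ha hc hac
  have := hne hb hc hbc
  omega

/-- A set of edges of a caterpillar without common endpoints has at most as many elements as there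
are cutpoints. -/
theorem IsCaterpillar.ncard_le_of_isIndepSet (hT : T.IsCaterpillar) {M : Set T.edgeSet}
    (hM : T.lineGraph.IsIndepSet M) : M.ncard ≤ {v : V | T.IsCutpoint v}.ncard := by
  choose f hf hfe using hT.exists_isCutpoint_mem
  refine Set.ncard_le_ncard_of_injOn f (fun e _ => hf e) fun e he e' he' hee' => ?_
  by_contra hne
  exact hM he he' hne (lineGraph_adj_iff_exists.mpr ⟨hne, f e, hfe e, hee' ▸ hfe e'⟩)

/-- If all cutpoints of a caterpillar have degree at least three, there is a matching with as many
edges as there are cutpoints. -/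
theorem IsCaterpillar.exists_isIndepSet_ncard_eq (hT : T.IsCaterpillar)
    (hdeg : ∀ v : V, T.IsCutpoint v → 3 ≤ T.degree v) :
    ∃ M : Set T.edgeSet, T.lineGraph.IsIndepSet M ∧
      M.ncard = {v : V | T.IsCutpoint v}.ncard := by
  choose! f hf hf1 using fun v hv => hT.exists_adj_degree_eq_one (hdeg v hv)
  have hleaf {v w : V} (hv : T.IsCutpoint v) (hw : T.IsCutpoint w) : f v ≠ w := fun h => by
    have h1 := hf1 v hv
    have h3 := hdeg w hw
    rw [h] at h1
    omega
  have hinj {v w : V} (hv : T.IsCutpoint v) (hw : T.IsCutpoint w) (h : f v = f w) : v = w := by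
    exact (degree_eq_one_iff_existsUnique_adj.mp (hf1 v hv)).unique (hf v hv).symm
      (h ▸ (hf w hw).symm)
  let g : {v : V | T.IsCutpoint v} → T.edgeSet := fun v => ⟨s(v.1, f v.1), hf v.1 v.2⟩
  -- Pendant edges at distinct cutpoints are disjoint: no chosen leaf is a cutpoint, and a leaf has
  -- only one neighbour.
  have hg {v w : {v : V | T.IsCutpoint v}} {x : V} (hv : x ∈ (g v).1) (hw : x ∈ (g w).1) :
      v = w := by
    have h₁ := hleaf v.2 w.2
    have h₂ := hleaf w.2 v.2
    have h₃ := hinj v.2 w.2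
    refine Subtype.ext ?_
    simp only [g, Sym2.mem_iff] at hv hw
    grind
  refine ⟨Set.range g, ?_, ?_⟩
  · rintro _ ⟨v, rfl⟩ _ ⟨w, rfl⟩ hne hadj
    obtain ⟨-, x, hxv, hxw⟩ := lineGraph_adj_iff_exists.mp hadj
    exact hne (congrArg g (hg hxv hxw))
  · have hginj : Function.Injective g := fun v w h =>
      hg (x := v.1) (by simp [g]) (h ▸ by simp [g])
    rw [← Set.image_univ, Set.ncard_image_of_injective _ hginj, Set.ncard_univ,
      Nat.card_coe_set_eq]

theorem IsCaterpillar.isLeast_isVertexCover_lineGraph (hT : T.IsCaterpillar)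
    (hdeg : ∀ v : V, T.IsCutpoint v → 3 ≤ T.degree v) :
    IsLeast {m : ℕ | ∃ C : Set T.edgeSet, T.lineGraph.IsVertexCover C ∧ C.ncard = m}
      (Nat.card T.edgeSet - {v : V | T.IsCutpoint v}.ncard) := by
  constructor
  · obtain ⟨M, hM, hcard⟩ := hT.exists_isIndepSet_ncard_eq hdeg
    exact ⟨Mᶜ, isVertexCover_compl.mpr hM, by rw [Set.ncard_compl, hcard]⟩
  · rintro _ ⟨C, hC, rfl⟩
    have h := hT.ncard_le_of_isIndepSet (isIndepSet_compl_iff_isVertexCover.mpr hC)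
    have := Set.ncard_add_ncard_compl C
    omega

end Caterpillar

end SimpleGraph

theorem corollary3p7 {V : Type*} [Fintype V] (T : SimpleGraph V) [DecidableRel T.Adj]
    (k : Type*) [Field k] (n s : ℕ)
    (hT : T.IsCaterpillar)
    (hn : Fintype.card V = n)
    (hs : {v : V | T.IsCutpoint v}.ncard = s)
    (hdeg : ∀ v : V, T.IsCutpoint v → 3 ≤ T.degree v) :
    s + 1 ≤ n ∧
    (T.lineGraph.edgeIdeal k).height = ((n - 1 - s : ℕ) : ℕ∞) ∧
    IsLeast {m : ℕ | ∃ C : Set T.edgeSet, Minimal T.lineGraph.IsVertexCover C ∧ C.ncard = m}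
      (n - 1 - s) := by
  have hcard : Nat.card T.edgeSet + 1 = n := by
    rw [← hn, ← hT.1.card_edgeFinset, SimpleGraph.edgeFinset_card, Nat.card_eq_fintype_card]
  have hleast := hT.isLeast_isVertexCover_lineGraph hdeg
  rw [hs, show Nat.card T.edgeSet = n - 1 by omega] at hleast
  refine ⟨?_, SimpleGraph.height_edgeIdeal_eq hleast,
    SimpleGraph.isLeast_minimal_isVertexCover hleast⟩
  -- The matching of `s` edges lies among the `n - 1` edges of `T`.
  obtain ⟨M, -, hM⟩ := hT.exists_isIndepSet_ncard_eq hdeg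
  have := Set.ncard_le_card M
  omega
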